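/- **Setting.** Let $f:\mathcal X\to\mathbb R$ be a closed differentiable function on an open domain $\mathcal X\subseteq\mathbb R^d$ (closed: all sublevel sets $\{x\in\mathcal X: f(x)\le a\}$ are closed in $\mathbb R^d$), bounded from below, with $f^*=\inf_{\mathcal X}f$. Suppose that $f$ is $(r,\ell)$-smooth: $r,\ell:[0,\infty)\to(0,\infty)$ with $\ell$ non-decreasing and $r$ non-increasing, and for every $x\in\mathcal X$ the closed ball $\mathcal B(x,r(\|\nabla f(x)\|))$ lies in $\mathcal X$ and $\|\nabla f(x_1)-\nabla f(x_2)\|\le \ell(\|\nabla f(x)\|)\,\|x_1-x_2\|$ for all $x_1,x_2$ in this ball. Suppose that $\ell$ is sub-quadratic, $\ell(u)=o(u^2)$ as $u\to\infty$. Let $x_0\in\mathcal X$, $\Delta_0=f(x_0)-f^*$, $\sigma\ge 0$ and $0<\delta<1$. SGD with stepsize $\eta>0$ is $x_{t+1}=x_t-\eta g_t$, where the random vectors $g_t$ are such that the noise $\epsilon_t=g_t-\nabla f(x_t)$ satisfies $\mathbb E_{t-1}[\epsilon_t]=0$ and $\mathbb E_{t-1}[\|\epsilon_t\|^2]\le\sigma^2$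 for all $t\ge 0$; here $\mathbb E_{t-1}$ is the expectation conditioned on $\{g_s\}_{s<t}$, and these conditions are required only as long as $x_0,\dots,x_t\in\mathcal X$ (on the event $\{x_0,\dots,x_t\in\mathcal X\}$). **Theorem.** 1. There is a constant $G>0$ with $$G\ge\max\Big\{40\sqrt{(\Delta_0+2\sigma)\,\ell(G)/\delta},\;2\|\nabla f(x_0)\|,\;\sigma\Big\}.\tag{$*$}$$ 2. Let $G>0$ be any constant satisfying $(*)$; put $L=\ell(G)$ and $C=\max\big\{G^2,\frac{400\sigma^2}{r(G)^2\delta}\big\}$. For every $\epsilon>0$, every stepsize $$0<\eta\le\min\Big\{\frac{\delta}{160L},\;\frac{r(G)}{2G},\;\frac{\delta\epsilon^2}{8C(\Delta_0+2\sigma)}\Big\}$$ (the last term being $+\infty$ if $\Delta_0+2\sigma=0$) and $T=\frac1{C\eta^2}$, the iterates of SGD satisfy, with probability at least $1-\delta$, $$x_t\in\mathcal X\ \text{ and }\ \|\nabla f(x_t)\|\le G\quad\text{for all integers } 0\le t<T,\qquad\text{and}\qquad \frac1T\sum_{0\le t<T}\|\nabla f(x_t)\|^2\le\epsilon^2 .$$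 3. Consequently SGD has complexity $O(\epsilon^{-4})$: for every such $G$ there is a constant $K>0$ such that for every $0<\epsilon\le1$ there is a stepsize $\eta$ allowed in 2 for which the number of iterations satisfies $\lceil T\rceil\le K\epsilon^{-4}$, and with probability at least $1-\delta$ some $t<\lceil T\rceil$ has $x_t\in\mathcal X$ and $\|\nabla f(x_t)\|\le\epsilon$. -/

import Mathlib

open MeasureTheory

namespace GenSmooth

/-- `f` is closed on its domain `X`: all sublevel sets `{x ∈ X | f x ≤ a}` are closed. -/
def IsClosedFunction {d : ℕ} (X : Set (EuclideanSpace ℝ (Fin d)))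
    (f : EuclideanSpace ℝ (Fin d) → ℝ) : Prop :=
  ∀ a : ℝ, IsClosed {x | x ∈ X ∧ f x ≤ a}

/-- Standing assumptions on the objective `f` with domain `X`: the domain is open, `f` is closed
and differentiable on it, and `f` is bounded from below on it. Only the values of `f` on `X`
matter. -/
structure IsObjective {d : ℕ} (X : Set (EuclideanSpace ℝ (Fin d)))
    (f : EuclideanSpace ℝ (Fin d) → ℝ) : Prop where
  isOpen : IsOpen X
  closed : IsClosedFunction X f
  differentiable : DifferentiableOn ℝ f X
  bddBelow : BddBelow (f '' X)

/-- `(r, ℓ)`-smoothness of `f` on `X`, for functions `r, ℓ : [0, ∞) → (0, ∞)` (given as functions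
on `ℝ` of which only the restriction to `[0, ∞)` matters). -/
structure IsRLSmooth {d : ℕ} (X : Set (EuclideanSpace ℝ (Fin d)))
    (f : EuclideanSpace ℝ (Fin d) → ℝ) (r ℓ : ℝ → ℝ) : Prop where
  r_pos : ∀ u, 0 ≤ u → 0 < r u
  l_pos : ∀ u, 0 ≤ u → 0 < ℓ u
  r_antitone : AntitoneOn r (Set.Ici 0)
  l_monotone : MonotoneOn ℓ (Set.Ici 0)
  ball_subset : ∀ x ∈ X, Metric.closedBall x (r ‖gradient f x‖) ⊆ X
  lipschitz : ∀ x ∈ X, ∀ x₁ ∈ Metric.closedBall x (r ‖gradient f x‖),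
    ∀ x₂ ∈ Metric.closedBall x (r ‖gradient f x‖),
      ‖gradient f x₁ - gradient f x₂‖ ≤ ℓ ‖gradient f x‖ * ‖x₁ - x₂‖

/-- `ℓ` is sub-quadratic: `ℓ(u) = o(u²)` as `u → ∞`. -/
def IsSubQuadratic (ℓ : ℝ → ℝ) : Prop :=
  Asymptotics.IsLittleO Filter.atTop ℓ (fun u : ℝ => u ^ 2)

/-- The initial sub-optimality gap `f(x₀) - inf_X f`. -/
noncomputable def initialGap {d : ℕ} (X : Set (EuclideanSpace ℝ (Fin d)))
    (f : EuclideanSpace ℝ (Fin d) → ℝ) (x₀ : EuclideanSpace ℝ (Fin d)) : ℝ :=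
  f x₀ - sInf (f '' X)

/-- The σ-algebra generated by `g s`, `s < t`. -/
abbrev pastSigma {d : ℕ} {Ω : Type*} (g : ℕ → Ω → EuclideanSpace ℝ (Fin d)) (t : ℕ) :
    MeasurableSpace Ω :=
  ⨆ s ∈ Set.Iio t, MeasurableSpace.comap (g s) inferInstance

/-- The gradient noise `ε_t = g_t - ∇f(x_t)`, considered as long as the iterates `x_0, …, x_t`
are in the domain `X` (where `∇f(x_t)` makes sense) and set to `0` once they have left it. If
`X` is the whole space this is `g_t - ∇f(x_t)`. -/
noncomputable def gradNoise {d : ℕ} {Ω : Type*} (X : Set (EuclideanSpace ℝ (Fin d)))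
    (f : EuclideanSpace ℝ (Fin d) → ℝ) (g x : ℕ → Ω → EuclideanSpace ℝ (Fin d)) (t : ℕ) :
    Ω → EuclideanSpace ℝ (Fin d) :=
  Set.indicator {ω | ∀ s ≤ t, x s ω ∈ X} (fun ω => g t ω - gradient f (x t ω))

/-- `x` are the iterates of SGD with constant stepsize `η` started at `x₀`, driven by the
stochastic gradients `g`, whose noise is conditionally unbiased with conditional variance at most
`σ²` given the past stochastic gradients. -/
structure IsSGDRun {d : ℕ} {Ω : Type*} [MeasurableSpace Ω] (μ : Measure Ω)
    (X : Set (EuclideanSpace ℝ (Fin d))) (f : EuclideanSpace ℝ (Fin d) → ℝ) (σ η : ℝ)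
    (x₀ : EuclideanSpace ℝ (Fin d)) (g x : ℕ → Ω → EuclideanSpace ℝ (Fin d)) : Prop where
  measurable : ∀ t, Measurable (g t)
  init : ∀ ω, x 0 ω = x₀
  step : ∀ t ω, x (t + 1) ω = x t ω - η • g t ω
  memLp : ∀ t, MemLp (gradNoise X f g x t) 2 μ
  unbiased : ∀ t, μ[gradNoise X f g x t | pastSigma g t] =ᵐ[μ] 0
  variance : ∀ t, μ[fun ω => ‖gradNoise X f g x t ω‖ ^ 2 | pastSigma g t] ≤ᵐ[μ] fun _ => σ ^ 2

/-- The condition on the gradient bound `G > 0`, where `Δ₀` is the initial sub-optimality gap and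
`γ` the norm of the initial gradient. -/
def IsGradBound (ℓ : ℝ → ℝ) (Δ₀ γ σ δ G : ℝ) : Prop :=
  0 < G ∧ max (max (40 * √((Δ₀ + 2 * σ) * ℓ G / δ)) (2 * γ)) σ ≤ G

/-- `C = max {G², 400 σ² / (r(G)² δ)}`. -/
noncomputable def noiseConst (r : ℝ → ℝ) (σ δ G : ℝ) : ℝ :=
  max (G ^ 2) (400 * σ ^ 2 / (r G ^ 2 * δ))

/-- `0 < η ≤ min {δ / (160 L), r(G) / (2 G), δ ε² / (8 C (Δ₀ + 2 σ))}` with `L = ℓ(G)`. The last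
bound is written without division; it is void if `Δ₀ + 2 σ = 0`. -/
def IsStepsize (r ℓ : ℝ → ℝ) (Δ₀ σ δ G ε η : ℝ) : Prop :=
  0 < η ∧ η ≤ min (δ / (160 * ℓ G)) (r G / (2 * G)) ∧
    η * (8 * noiseConst r σ δ G * (Δ₀ + 2 * σ)) ≤ δ * ε ^ 2

/-- `T = 1 / (C η²)`, a real number; the indices `t < T` are the `t < ⌈T⌉`. -/
noncomputable def horizon (r : ℝ → ℝ) (σ δ G η : ℝ) : ℝ :=
  1 / (noiseConst r σ δ G * η ^ 2)

end GenSmooth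

/-!
The iterates are followed as long as they stay in a region where the gradient is at most `G / 2`
and the gap `f - inf f` is at most `F = G² / (200 ℓ(G))`, and as long as the noise stays below a
threshold `B` of order `1 / η` (`goodEvent`).

Deterministically, the gradient-gap inequality `‖∇f(x)‖² ≤ 2 ℓ(G) (f(x) - inf f)` holds wherever
`‖∇f(x)‖ ≤ G / 2` (`sq_norm_gradient_le`): the ray in direction `-∇f(x)` can be followed in short
steps inside `X`, since the radius `r(G)` is available at each point reached. Hence the gradient is
in fact at most `G / 10` in that region, and one step with noise at most `B` can neither leave `X`
nor raise the gradient above `G / 2`, while `f` obeys the usual descent inequality (`noisy_step`).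
A run can therefore stop being good only through a noise larger than `B` or through a jump of the
gap above `F`.

The event of being good up to time `t` depends on the past only, so multiplying the noise by its
indicator keeps it a martingale difference. When the noise is large the descent inequality fails,
but the inner product that remains is at most of order `‖ε‖² / B`. This gives the pathwise drift
inequality `IsSGDRun.drift`; its expectation, summed over `⌈T⌉ ≤ 2 T` steps, bounds both
`F` times the probability of a jump of the gap and `η / 2` times the expected sum of the squared
gradients of good runs by `Δ₀ + 2 σ` (`IsSGDRun.sum_drift`, `drift_noise_le`). The inequalities of
Markov and Chebyshev conclude (`IsSGDRun.convergence`). If `T < 1`, only the iterate `x₀` counts,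
and the claim is deterministic.
-/

namespace GenSmooth

/-! ### Local smoothness, descent, and the gradient-gap inequality -/

section Deterministic

variable {d : ℕ} {X : Set (EuclideanSpace ℝ (Fin d))} {f : EuclideanSpace ℝ (Fin d) → ℝ}
  {r ℓ : ℝ → ℝ} {G : ℝ} {x y z : EuclideanSpace ℝ (Fin d)}

theorem IsObjective.hasGradientAt (hf : IsObjective X f) (hx : x ∈ X) :
    HasGradientAt f (gradient f x) x :=
  (hf.differentiable.differentiableAt (hf.isOpen.mem_nhds hx)).hasGradientAt

theorem IsObjective.sInf_le (hf : IsObjective X f) (hx : x ∈ X) : sInf (f '' X) ≤ f x :=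
  csInf_le hf.bddBelow ⟨x, hx, rfl⟩

theorem IsRLSmooth.closedBall_subset (h : IsRLSmooth X f r ℓ) (hx : x ∈ X)
    (hG : ‖gradient f x‖ ≤ G) : Metric.closedBall x (r G) ⊆ X :=
  (Metric.closedBall_subset_closedBall
    (h.r_antitone (norm_nonneg _) ((norm_nonneg _).trans hG) hG)).trans (h.ball_subset x hx)

theorem IsRLSmooth.norm_gradient_sub_le (h : IsRLSmooth X f r ℓ) (hx : x ∈ X)
    (hG : ‖gradient f x‖ ≤ G) (hy : y ∈ Metric.closedBall x (r G))
    (hz : z ∈ Metric.closedBall x (r G)) :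
    ‖gradient f y - gradient f z‖ ≤ ℓ G * ‖y - z‖ := by
  have hr : r G ≤ r ‖gradient f x‖ :=
    h.r_antitone (norm_nonneg _) ((norm_nonneg _).trans hG) hG
  have hl : ℓ ‖gradient f x‖ ≤ ℓ G :=
    h.l_monotone (norm_nonneg _) ((norm_nonneg _).trans hG) hG
  exact (h.lipschitz x hx y (Metric.closedBall_subset_closedBall hr hy) z
    (Metric.closedBall_subset_closedBall hr hz)).trans
    (mul_le_mul_of_nonneg_right hl (norm_nonneg _))

theorem IsRLSmooth.continuousOn_gradient (h : IsRLSmooth X f r ℓ) :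
    ContinuousOn (gradient f) X := by
  intro x hx
  have hr := h.r_pos _ (norm_nonneg (gradient f x))
  have hlip : LipschitzOnWith (Real.toNNReal (ℓ ‖gradient f x‖)) (gradient f)
      (Metric.closedBall x (r ‖gradient f x‖)) := by
    refine LipschitzOnWith.of_dist_le_mul fun y hy z hz => ?_
    rw [dist_eq_norm, dist_eq_norm, Real.coe_toNNReal _ (h.l_pos _ (norm_nonneg _)).le]
    exact h.lipschitz x hx y hy z hz
  exact (hlip.continuousOn.continuousAt (Metric.closedBall_mem_nhds x hr)).continuousWithinAt

/-- The quadratic upper bound for `f` on the ball in which its gradient is `ℓ G`-Lipschitz. -/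
theorem IsRLSmooth.le_quadratic (hf : IsObjective X f) (h : IsRLSmooth X f r ℓ) (hx : x ∈ X)
    (hG : ‖gradient f x‖ ≤ G) (hy : y ∈ Metric.closedBall x (r G)) :
    f y ≤ f x + inner ℝ (gradient f x) (y - x) + ℓ G / 2 * ‖y - x‖ ^ 2 := by
  set v := y - x with hv
  have hr : 0 ≤ r G := (dist_nonneg).trans hy
  have hvr : ‖v‖ ≤ r G := by rw [hv, ← dist_eq_norm]; exact hy
  have hmem : ∀ s ∈ Set.Icc (0 : ℝ) 1, x + s • v ∈ Metric.closedBall x (r G) := by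
    intro s hs
    rw [Metric.mem_closedBall, dist_eq_norm, add_sub_cancel_left, norm_smul, Real.norm_eq_abs,
      abs_of_nonneg hs.1]
    nlinarith [hs.2, norm_nonneg v]
  let φ : ℝ → ℝ := fun s => f (x + s • v) - s * inner ℝ (gradient f x) v
    - ℓ G / 2 * ‖v‖ ^ 2 * s ^ 2
  have hφ : ∀ s ∈ Set.Icc (0 : ℝ) 1, HasDerivAt φ
      (inner ℝ (gradient f (x + s • v)) v - inner ℝ (gradient f x) v
        - ℓ G / 2 * ‖v‖ ^ 2 * (2 * s)) s := by
    intro s hs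
    have h1 := (hf.hasGradientAt (h.closedBall_subset hx hG (hmem s hs))).hasFDerivAt
    have h2 : HasDerivAt (fun s : ℝ => x + s • v) v s := by
      simpa using ((hasDerivAt_id s).smul_const v).const_add x
    have h3 := h1.comp_hasDerivAt s h2
    have h4 := (h3.sub ((hasDerivAt_id s).mul_const (inner ℝ (gradient f x) v))).sub
      (((hasDerivAt_id s).pow 2).const_mul (ℓ G / 2 * ‖v‖ ^ 2))
    refine h4.congr_deriv ?_
    simp
  have hanti : AntitoneOn φ (Set.Icc 0 1) := by
    refine antitoneOn_of_deriv_nonpos (convex_Icc 0 1)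
      (fun s hs => (hφ s hs).continuousAt.continuousWithinAt)
      (fun s hs => (hφ s (interior_subset hs)).differentiableAt.differentiableWithinAt)
      fun s hs => ?_
    have hs' := interior_subset hs
    rw [(hφ s hs').deriv, ← inner_sub_left]
    have h1 := real_inner_le_norm (gradient f (x + s • v) - gradient f x) v
    have h2 := h.norm_gradient_sub_le hx hG (hmem s hs') (Metric.mem_closedBall_self hr)
    rw [add_sub_cancel_left, norm_smul, Real.norm_eq_abs, abs_of_nonneg hs'.1] at h2
    nlinarith [mul_le_mul_of_nonneg_right h2 (norm_nonneg v)]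
  have h01 := hanti (Set.left_mem_Icc.2 zero_le_one) (Set.right_mem_Icc.2 zero_le_one) zero_le_one
  have hxv : x + v = y := by rw [hv]; abel
  simp only [φ, one_smul, zero_smul, add_zero, hxv] at h01
  linarith

/-- The gradient-gap inequality. As long as the gradient has norm at most `G`, the function can be
followed along the ray from `x` in direction `-∇f(x)` in steps of length `r G`, its gradient moving
at rate at most `ℓ G`. If `‖∇f(x)‖ ≤ G / 2`, the gradient stays below `G` up to time
`1 / ℓ G`, by which `f` has dropped by `‖∇f(x)‖² / (2 ℓ G)`. -/
theorem sq_norm_gradient_le (hf : IsObjective X f) (h : IsRLSmooth X f r ℓ) (hx : x ∈ X)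
    (hG : ‖gradient f x‖ ≤ G / 2) :
    ‖gradient f x‖ ^ 2 ≤ 2 * ℓ G * (f x - sInf (f '' X)) := by
  set p := gradient f x with hp
  set u := ‖p‖ with hu
  have hu0 : 0 ≤ u := norm_nonneg _
  have hG0 : 0 ≤ G := by linarith
  have hL := h.l_pos G hG0
  have hr := h.r_pos G hG0
  set L := ℓ G with hLdef
  obtain ⟨n, hn⟩ := exists_nat_gt (u / (L * r G))
  have hn0 : (0 : ℝ) < n := lt_of_le_of_lt (by positivity) hn
  have hstep : u / (n * L) ≤ r G := by
    rw [div_lt_iff₀ (by positivity)] at hn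
    rw [div_le_iff₀ (by positivity)]
    nlinarith
  -- The invariant after `k` of `n` equal steps; the decrease `s - s ^ 2 / 2` at `s = k / n` is
  -- exactly what the quadratic upper bounds of the steps add up to.
  have key : ∀ k : ℕ, k ≤ n → ∀ y, y = x - ((k : ℝ) / (n * L)) • p →
      y ∈ X ∧ ‖gradient f y - p‖ ≤ k / n * u ∧
        f y ≤ f x - u ^ 2 / L * ((k : ℝ) / n - ((k : ℝ) / n) ^ 2 / 2) := by
    intro k
    induction k with
    | zero =>
      rintro - y rfl
      simp [hx, hp]
    | succ k ih =>
      rintro hk z hz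
      obtain ⟨hyX, hyg, hyf⟩ := ih (by omega) _ rfl
      set y := x - ((k : ℝ) / (n * L)) • p with hy
      have hkn : (k : ℝ) / n ≤ 1 := by
        rw [div_le_one hn0]; exact_mod_cast (by omega : k ≤ n)
      have hyG : ‖gradient f y‖ ≤ G := by
        have := norm_le_norm_add_norm_sub' (gradient f y) p
        nlinarith
      have hzy : z - y = -((1 / (n * L)) • p) := by
        rw [hz, hy]
        push_cast
        rw [add_div, add_smul]
        abel
      have hnzy : ‖z - y‖ = u / (n * L) := by
        rw [hzy, norm_neg, norm_smul, Real.norm_eq_abs, abs_of_pos (by positivity)]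
        ring
      have hzb : z ∈ Metric.closedBall y (r G) := by
        rw [Metric.mem_closedBall, dist_eq_norm, hnzy]; exact hstep
      refine ⟨h.closedBall_subset hyX hyG hzb, ?_, ?_⟩
      · have h1 := h.norm_gradient_sub_le hyX hyG hzb (Metric.mem_closedBall_self hr.le)
        rw [hnzy] at h1
        have h2 : L * (u / (n * L)) = u / n := by field_simp
        have h3 := norm_sub_le_norm_sub_add_norm_sub (gradient f z) (gradient f y) p
        push_cast
        rw [add_div, add_mul]
        have h4 : 1 / (n : ℝ) * u = u / n := by ring
        linarith
      · have h1 := h.le_quadratic hf hyX hyG hzb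
        rw [hnzy, hzy, inner_neg_right, inner_smul_right] at h1
        have h2 : u ^ 2 - k / n * u * u ≤ inner ℝ (gradient f y) p := by
          have h3 := real_inner_le_norm (p - gradient f y) p
          rw [inner_sub_left, real_inner_self_eq_norm_sq, norm_sub_rev] at h3
          nlinarith
        have h3 := mul_le_mul_of_nonneg_left h2 (by positivity : 0 ≤ 1 / (n * L))
        refine h1.trans ?_
        have h5 : f x - u ^ 2 / L * ((k : ℝ) / n - ((k : ℝ) / n) ^ 2 / 2)
            - 1 / (n * L) * (u ^ 2 - k / n * u * u) + L / 2 * (u / (n * L)) ^ 2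
            = f x - u ^ 2 / L * (((k + 1 : ℕ) : ℝ) / n - (((k + 1 : ℕ) : ℝ) / n) ^ 2 / 2) := by
          push_cast
          field_simp
          ring
        linarith
  obtain ⟨hyX, -, hyf⟩ := key n le_rfl _ rfl
  have h1 := hf.sInf_le hyX
  rw [div_self hn0.ne'] at hyf
  have h2 : u ^ 2 / L * (1 - 1 ^ 2 / 2) ≤ f x - sInf (f '' X) := by linarith
  have h3 : u ^ 2 = 2 * L * (u ^ 2 / L * (1 - 1 ^ 2 / 2)) := by field_simp; norm_num
  rw [h3]
  exact mul_le_mul_of_nonneg_left h2 (by positivity)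

/-- One gradient step with noise `e`, in the regime in which the step stays in the ball of radius
`r G` and moves the gradient by at most `2 G / 5`: the gradient bound survives, and `f`
decreases up to the noise terms. -/
theorem noisy_step (hf : IsObjective X f) (h : IsRLSmooth X f r ℓ) {η B : ℝ} (hη : 0 < η)
    (hG0 : 0 < G) (hLη : ℓ G * η ≤ 1 / 160) (hGη : η * G ≤ r G / 2) (hBr : η * B ≤ r G / 2)
    (hBG : ℓ G * (η * B) ≤ G / 4) (hx : x ∈ X) (hxG : ‖gradient f x‖ ≤ G / 10)
    {e : EuclideanSpace ℝ (Fin d)} (he : ‖e‖ ≤ B) (hz : z = x - η • (gradient f x + e)) :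
    z ∈ X ∧ ‖gradient f z‖ ≤ G / 2 ∧
      f z + η / 2 * ‖gradient f x‖ ^ 2
        ≤ f x - η * inner ℝ (gradient f x) e + ℓ G * η ^ 2 * ‖e‖ ^ 2 := by
  set p := gradient f x with hp
  have hL := h.l_pos G hG0.le
  have hr := h.r_pos G hG0.le
  have hxG' : ‖p‖ ≤ G := by linarith
  have hzx : z - x = -(η • (p + e)) := by rw [hz]; abel
  have hnorm : ‖z - x‖ = η * ‖p + e‖ := by
    rw [hzx, norm_neg, norm_smul, Real.norm_eq_abs, abs_of_pos hη]
  have hpe : ‖p + e‖ ≤ G / 10 + B := (norm_add_le _ _).trans (add_le_add hxG he)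
  have hstep : ‖z - x‖ ≤ η * G / 10 + η * B := by
    rw [hnorm]; nlinarith
  have hball : z ∈ Metric.closedBall x (r G) := by
    rw [Metric.mem_closedBall, dist_eq_norm]; nlinarith [mul_pos hη hG0]
  refine ⟨h.closedBall_subset hx hxG' hball, ?_, ?_⟩
  · have h1 := h.norm_gradient_sub_le hx hxG' hball (Metric.mem_closedBall_self hr.le)
    have h2 := norm_le_norm_add_norm_sub' (gradient f z) p
    have h3 : ℓ G * ‖z - x‖ ≤ ℓ G * (η * G / 10 + η * B) :=
      mul_le_mul_of_nonneg_left hstep hL.le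
    have h4 : ℓ G * η * G ≤ 1 / 160 * G := mul_le_mul_of_nonneg_right hLη hG0.le
    nlinarith
  · have h1 := h.le_quadratic hf hx hxG' hball
    rw [hnorm, hzx, inner_neg_right, inner_smul_right, inner_add_right,
      real_inner_self_eq_norm_sq] at h1
    have h2 : ‖p + e‖ ^ 2 ≤ 2 * ‖p‖ ^ 2 + 2 * ‖e‖ ^ 2 := by
      have := parallelogram_law_with_norm ℝ p e
      nlinarith [mul_self_nonneg ‖p - e‖]
    have h3 : ℓ G / 2 * (η * ‖p + e‖) ^ 2 ≤ ℓ G * η * (η * ‖p‖ ^ 2) + ℓ G * η ^ 2 * ‖e‖ ^ 2 := by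
      have := mul_le_mul_of_nonneg_left h2 (by positivity : 0 ≤ ℓ G / 2 * η ^ 2)
      nlinarith
    have h4 : ℓ G * η * (η * ‖p‖ ^ 2) ≤ 1 / 160 * (η * ‖p‖ ^ 2) :=
      mul_le_mul_of_nonneg_right hLη (by positivity)
    nlinarith [mul_nonneg hη.le (sq_nonneg ‖p‖)]

end Deterministic

/-! ### Measurability and moments along a run -/

theorem pastSigma_mono {d : ℕ} {Ω : Type*} {g : ℕ → Ω → EuclideanSpace ℝ (Fin d)}
    {s t : ℕ} (h : s ≤ t) : pastSigma g s ≤ pastSigma g t :=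
  biSup_mono fun _ hi => lt_of_lt_of_le hi h

theorem measurable_pastSigma {d : ℕ} {Ω : Type*} {g : ℕ → Ω → EuclideanSpace ℝ (Fin d)}
    {s t : ℕ} (h : s < t) : Measurable[pastSigma g t] (g s) := by
  rw [measurable_iff_comap_le]
  exact le_biSup (fun s => MeasurableSpace.comap (g s) inferInstance) (Set.mem_Iio.2 h)

section Run

variable {d : ℕ} {Ω : Type*} [mΩ : MeasurableSpace Ω] {μ : Measure Ω}
  {X : Set (EuclideanSpace ℝ (Fin d))} {f : EuclideanSpace ℝ (Fin d) → ℝ}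
  {r ℓ : ℝ → ℝ} {σ η : ℝ} {x₀ : EuclideanSpace ℝ (Fin d)}
  {g x : ℕ → Ω → EuclideanSpace ℝ (Fin d)}

theorem measurable_indicator_of_continuousOn {E F : Type*} [TopologicalSpace E]
    [MeasurableSpace E] [BorelSpace E] [TopologicalSpace F] [MeasurableSpace F] [BorelSpace F]
    [Zero F] {s : Set E} {φ : E → F} (hs : IsOpen s) (hφ : ContinuousOn φ s) :
    Measurable (s.indicator φ) := by
  classical
  rw [← Set.piecewise_eq_indicator]
  exact hφ.measurable_piecewise continuousOn_const hs.measurableSet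

namespace IsSGDRun

theorem pastSigma_le (run : IsSGDRun μ X f σ η x₀ g x) (t : ℕ) : pastSigma g t ≤ mΩ :=
  iSup₂_le fun s _ => (run.measurable s).comap_le

theorem measurable_iterate (run : IsSGDRun μ X f σ η x₀ g x) (t : ℕ) :
    Measurable[pastSigma g t] (x t) := by
  induction t with
  | zero =>
    have : x 0 = fun _ => x₀ := funext run.init
    rw [this]; exact measurable_const
  | succ t ih =>
    have : x (t + 1) = fun ω => x t ω - η • g t ω := funext (run.step t)
    rw [this]
    exact (ih.mono (pastSigma_mono t.le_succ) le_rfl).sub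
      ((measurable_pastSigma t.lt_succ_self).const_smul η)

theorem measurable_iterate_of_le (run : IsSGDRun μ X f σ η x₀ g x) {s t : ℕ} (h : s ≤ t) :
    Measurable[pastSigma g t] (x s) :=
  (run.measurable_iterate s).mono (pastSigma_mono h) le_rfl

theorem measurableSet_stay (run : IsSGDRun μ X f σ η x₀ g x) (hX : IsOpen X) {s t : ℕ}
    (h : s ≤ t) : MeasurableSet[pastSigma g t] {ω | ∀ k ≤ s, x k ω ∈ X} := by
  have : {ω | ∀ k ≤ s, x k ω ∈ X} = ⋂ k ∈ Set.Iic s, x k ⁻¹' X := by ext; simp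
  rw [this]
  exact MeasurableSet.biInter (Set.to_countable _) fun k hk =>
    run.measurable_iterate_of_le (le_trans hk h) hX.measurableSet

theorem measurable_gradNoise (run : IsSGDRun μ X f σ η x₀ g x) (hf : IsObjective X f)
    (hs : IsRLSmooth X f r ℓ) {s t : ℕ} (h : s < t) :
    Measurable[pastSigma g t] (gradNoise X f g x s) := by
  have h1 : gradNoise X f g x s = Set.indicator {ω | ∀ k ≤ s, x k ω ∈ X}
      (fun ω => g s ω - X.indicator (gradient f) (x s ω)) := by
    refine Set.indicator_congr fun ω hω => ?_
    rw [Set.indicator_of_mem (hω s le_rfl)]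
  rw [h1]
  exact Measurable.indicator ((measurable_pastSigma h).sub
    ((measurable_indicator_of_continuousOn hf.isOpen hs.continuousOn_gradient).comp
      (run.measurable_iterate_of_le h.le))) (run.measurableSet_stay hf.isOpen h.le)

theorem integrable_sq_noise (run : IsSGDRun μ X f σ η x₀ g x) (t : ℕ) :
    Integrable (fun ω => ‖gradNoise X f g x t ω‖ ^ 2) μ :=
  (run.memLp t).integrable_norm_pow two_ne_zero

theorem integral_sq_noise_le [IsProbabilityMeasure μ] (run : IsSGDRun μ X f σ η x₀ g x) (t : ℕ) :
    ∫ ω, ‖gradNoise X f g x t ω‖ ^ 2 ∂μ ≤ σ ^ 2 := by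
  rw [← integral_condExp (run.pastSigma_le t)]
  exact (integral_mono_ae integrable_condExp (integrable_const _) (run.variance t)).trans
    (by simp)

/-- The noise is orthogonal to every bounded function of the past. -/
theorem integral_inner_noise [IsProbabilityMeasure μ] (run : IsSGDRun μ X f σ η x₀ g x) (t : ℕ)
    {Z : Ω → EuclideanSpace ℝ (Fin d)} (hZ : Measurable[pastSigma g t] Z) {c : ℝ}
    (hc : ∀ ω, ‖Z ω‖ ≤ c) :
    Integrable (fun ω => inner ℝ (Z ω) (gradNoise X f g x t ω)) μ ∧
      ∫ ω, inner ℝ (Z ω) (gradNoise X f g x t ω) ∂μ = 0 := by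
  have hint : Integrable (gradNoise X f g x t) μ := (run.memLp t).integrable one_le_two
  refine ⟨(innerSL ℝ).integrable_of_bilin_of_bdd_left c
    (hZ.mono (run.pastSigma_le t) le_rfl).aestronglyMeasurable (ae_of_all _ hc) hint, ?_⟩
  have h1 := condExp_stronglyMeasurable_bilin_of_bound (μ := μ)
    (innerSL ℝ (E := EuclideanSpace ℝ (Fin d))) (run.pastSigma_le t)
    hZ.stronglyMeasurable hint c (ae_of_all _ hc)
  have h2 : (fun ω => (innerSL ℝ (Z ω)) ((μ[gradNoise X f g x t | pastSigma g t]) ω))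
      =ᵐ[μ] fun _ => (0 : ℝ) := by
    filter_upwards [run.unbiased t] with ω hω
    simp [hω]
  have h3 := integral_congr_ae (h1.trans h2)
  rw [integral_condExp (run.pastSigma_le t), integral_zero] at h3
  exact h3

theorem measureReal_noise_gt_le [IsProbabilityMeasure μ] (run : IsSGDRun μ X f σ η x₀ g x) (t : ℕ)
    {B : ℝ} (hB : 0 < B) : μ.real {ω | B < ‖gradNoise X f g x t ω‖} ≤ σ ^ 2 / B ^ 2 := by
  have h1 := mul_meas_ge_le_integral_of_nonneg (μ := μ)
    (ae_of_all _ fun ω => sq_nonneg ‖gradNoise X f g x t ω‖) (run.integrable_sq_noise t) (B ^ 2)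
  have h2 : μ.real {ω | B < ‖gradNoise X f g x t ω‖}
      ≤ μ.real {ω | B ^ 2 ≤ ‖gradNoise X f g x t ω‖ ^ 2} :=
    measureReal_mono fun ω (hω : B < _) => pow_le_pow_left₀ hB.le hω.le 2
  rw [le_div_iff₀ (by positivity)]
  nlinarith [run.integral_sq_noise_le t, sq_pos_of_pos hB]

end IsSGDRun

end Run

/-! ### The drift inequality up to the first exit -/

/-- The iterates up to time `t` lie in `X`, with gap at most `F` and gradient norm at most `G / 2`,
and the noise before time `t` has norm at most `B`. This event depends on `g s`, `s < t`, only. -/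
def goodEvent {d : ℕ} {Ω : Type*} (X : Set (EuclideanSpace ℝ (Fin d)))
    (f : EuclideanSpace ℝ (Fin d) → ℝ) (g x : ℕ → Ω → EuclideanSpace ℝ (Fin d)) (G F B : ℝ)
    (t : ℕ) : Set Ω :=
  {ω | (∀ s ≤ t, x s ω ∈ X ∧ f (x s ω) - sInf (f '' X) ≤ F ∧ ‖gradient f (x s ω)‖ ≤ G / 2) ∧
    ∀ s < t, ‖gradNoise X f g x s ω‖ ≤ B}

/-- The run is good up to time `t`, the noise at time `t` has norm at most `B`, and the run is not
good up to time `t + 1`. -/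
def exitEvent {d : ℕ} {Ω : Type*} (X : Set (EuclideanSpace ℝ (Fin d)))
    (f : EuclideanSpace ℝ (Fin d) → ℝ) (g x : ℕ → Ω → EuclideanSpace ℝ (Fin d)) (G F B : ℝ)
    (t : ℕ) : Set Ω :=
  (goodEvent X f g x G F B t ∩ {ω | ‖gradNoise X f g x t ω‖ ≤ B}) \ goodEvent X f g x G F B (t + 1)

/-- The sizes of the gradient bound `G`, the stepsize `η` and the noise threshold `B` for which
`noisy_step` applies. -/
structure IsRegime (r ℓ : ℝ → ℝ) (η G B : ℝ) : Prop where
  η_pos : 0 < η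
  G_pos : 0 < G
  B_pos : 0 < B
  smooth : ℓ G * η ≤ 1 / 160
  radius : η * G ≤ r G / 2
  noise_radius : η * B ≤ r G / 2
  noise_smooth : ℓ G * (η * B) ≤ G / 4

section Drift

variable {d : ℕ} {Ω : Type*}
  {X : Set (EuclideanSpace ℝ (Fin d))} {f : EuclideanSpace ℝ (Fin d) → ℝ}
  {r ℓ : ℝ → ℝ} {σ η G F B : ℝ} {x₀ : EuclideanSpace ℝ (Fin d)}
  {g x : ℕ → Ω → EuclideanSpace ℝ (Fin d)} {t : ℕ} {ω : Ω}

theorem mem_of_mem_goodEvent (hω : ω ∈ goodEvent X f g x G F B t) : x t ω ∈ X :=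
  (hω.1 t le_rfl).1

/-- With `F = G² / (200 ℓ G)`, the gradient-gap inequality improves the bound `G / 2` to
`G / 10`; the slack absorbs one further step. -/
theorem norm_gradient_le_of_mem_goodEvent (hf : IsObjective X f) (hs : IsRLSmooth X f r ℓ)
    (hG : 0 < G) (hF : F = G ^ 2 / (200 * ℓ G)) (hω : ω ∈ goodEvent X f g x G F B t) :
    ‖gradient f (x t ω)‖ ≤ G / 10 := by
  obtain ⟨h1, h2, h3⟩ := hω.1 t le_rfl
  have hL := hs.l_pos G hG.le
  have h4 := sq_norm_gradient_le hf hs h1 h3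
  have h5 : 2 * ℓ G * (f (x t ω) - sInf (f '' X)) ≤ 2 * ℓ G * F :=
    mul_le_mul_of_nonneg_left h2 (by positivity)
  have h6 : 2 * ℓ G * F = (G / 10) ^ 2 := by rw [hF]; field_simp; norm_num
  exact le_of_sq_le_sq (by linarith) (by positivity)

theorem goodEvent_succ_subset : goodEvent X f g x G F B (t + 1) ⊆ goodEvent X f g x G F B t :=
  fun _ hω => ⟨fun s h => hω.1 s (h.trans t.le_succ), fun s h => hω.2 s (h.trans t.lt_succ_self)⟩

theorem mem_goodEvent_succ (h : ω ∈ goodEvent X f g x G F B t)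
    (hB : ‖gradNoise X f g x t ω‖ ≤ B) (hX : x (t + 1) ω ∈ X)
    (hF : f (x (t + 1) ω) - sInf (f '' X) ≤ F) (hG : ‖gradient f (x (t + 1) ω)‖ ≤ G / 2) :
    ω ∈ goodEvent X f g x G F B (t + 1) := by
  refine ⟨fun s hs => ?_, fun s hs => ?_⟩
  · rcases Nat.le_succ_iff.1 hs with hs | rfl
    · exact h.1 s hs
    · exact ⟨hX, hF, hG⟩
  · rcases Nat.lt_succ_iff_lt_or_eq.1 hs with hs | rfl
    · exact h.2 s hs
    · exact hB

theorem goodEvent_subset_of_le {s : ℕ} (h : s ≤ t) :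
    goodEvent X f g x G F B t ⊆ goodEvent X f g x G F B s :=
  antitone_nat_of_succ_le (fun _ => goodEvent_succ_subset) h

variable [mΩ : MeasurableSpace Ω] {μ : Measure Ω}

/-- The pathwise drift inequality. While the run is good it is `noisy_step`; at an exit with small
noise the gap has jumped above `F`; at an exit with large noise the left side vanishes and the
inner product is absorbed by `‖ε‖ ≤ ‖ε‖² / B`. -/
theorem IsSGDRun.drift (run : IsSGDRun μ X f σ η x₀ g x) (hf : IsObjective X f)
    (hs : IsRLSmooth X f r ℓ) (hreg : IsRegime r ℓ η G B) (hF : F = G ^ 2 / (200 * ℓ G))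
    (t : ℕ) (ω : Ω) :
    (goodEvent X f g x G F B (t + 1)).indicator
        (fun ω => f (x (t + 1) ω) - sInf (f '' X)) ω
      + η / 2 * (goodEvent X f g x G F B (t + 1)).indicator
          (fun ω => ‖gradient f (x t ω)‖ ^ 2) ω
      + F * (exitEvent X f g x G F B t).indicator 1 ω
    ≤ (goodEvent X f g x G F B t).indicator (fun ω => f (x t ω) - sInf (f '' X)) ω
      - η * inner ℝ ((goodEvent X f g x G F B t).indicator (fun ω => gradient f (x t ω)) ω)
          (gradNoise X f g x t ω)
      + (η * G / (10 * B) + ℓ G * η ^ 2) * ‖gradNoise X f g x t ω‖ ^ 2 := by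
  have hL := hs.l_pos G hreg.G_pos.le
  have hη := hreg.η_pos
  have hG := hreg.G_pos
  have hB := hreg.B_pos
  set e := gradNoise X f g x t ω with he
  by_cases hA : ω ∈ goodEvent X f g x G F B t
  swap
  · have hA' : ω ∉ goodEvent X f g x G F B (t + 1) := fun h => hA (goodEvent_succ_subset h)
    have hE : ω ∉ exitEvent X f g x G F B t := fun h => hA h.1.1
    simp only [Set.indicator_of_notMem hA, Set.indicator_of_notMem hA',
      Set.indicator_of_notMem hE, inner_zero_left]
    have : 0 ≤ (η * G / (10 * B) + ℓ G * η ^ 2) * ‖e‖ ^ 2 := by positivity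
    linarith
  simp only [Set.indicator_of_mem hA]
  have hxX := mem_of_mem_goodEvent hA
  have hxG := norm_gradient_le_of_mem_goodEvent hf hs hG hF hA
  have hgap := hf.sInf_le hxX
  by_cases hN : ‖e‖ ≤ B
  swap
  · have hA' : ω ∉ goodEvent X f g x G F B (t + 1) := fun h => hN (h.2 t t.lt_succ_self)
    have hE : ω ∉ exitEvent X f g x G F B t := fun h => hN h.1.2
    simp only [Set.indicator_of_notMem hA', Set.indicator_of_notMem hE]
    have h1 : inner ℝ (gradient f (x t ω)) e ≤ G / 10 * ‖e‖ :=
      (real_inner_le_norm _ _).trans (mul_le_mul_of_nonneg_right hxG (norm_nonneg _))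
    have h2 : ‖e‖ ≤ ‖e‖ ^ 2 / B := by
      rw [le_div_iff₀ hB]; nlinarith [norm_nonneg e]
    have h3 : η * inner ℝ (gradient f (x t ω)) e ≤ η * (G / 10 * (‖e‖ ^ 2 / B)) :=
      mul_le_mul_of_nonneg_left (h1.trans (mul_le_mul_of_nonneg_left h2 (by positivity))) hη.le
    have h4 : η * (G / 10 * (‖e‖ ^ 2 / B)) = η * G / (10 * B) * ‖e‖ ^ 2 := by field_simp
    have h5 : 0 ≤ ℓ G * η ^ 2 * ‖e‖ ^ 2 := by positivity
    nlinarith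
  have hz : x (t + 1) ω = x t ω - η • (gradient f (x t ω) + e) := by
    have : e = g t ω - gradient f (x t ω) :=
      Set.indicator_of_mem (s := {ω | ∀ s ≤ t, x s ω ∈ X}) (fun s h => (hA.1 s h).1) _
    rw [run.step, this, add_sub_cancel]
  obtain ⟨h1, h2, h3⟩ := noisy_step hf hs hη hG hreg.smooth hreg.radius hreg.noise_radius
    hreg.noise_smooth hxX hxG hN hz
  have h4 : 0 ≤ η * G / (10 * B) * ‖e‖ ^ 2 := by positivity
  by_cases hA' : ω ∈ goodEvent X f g x G F B (t + 1)
  · have hE : ω ∉ exitEvent X f g x G F B t := fun h => h.2 hA'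
    simp only [Set.indicator_of_mem hA', Set.indicator_of_notMem hE]
    nlinarith
  · have hE : ω ∈ exitEvent X f g x G F B t := ⟨⟨hA, hN⟩, hA'⟩
    have h5 : F < f (x (t + 1) ω) - sInf (f '' X) := by
      by_contra! h
      exact hA' (mem_goodEvent_succ hA hN h1 h h2)
    simp only [Set.indicator_of_notMem hA', Set.indicator_of_mem hE, Pi.one_apply]
    nlinarith [sq_nonneg ‖gradient f (x t ω)‖]

theorem IsSGDRun.measurableSet_goodEvent (run : IsSGDRun μ X f σ η x₀ g x)
    (hf : IsObjective X f) (hs : IsRLSmooth X f r ℓ) (t : ℕ) :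
    MeasurableSet[pastSigma g t] (goodEvent X f g x G F B t) := by
  have h1 : goodEvent X f g x G F B t =
      (⋂ s ∈ Set.Iic t, x s ⁻¹' (X ∩ {y | X.indicator f y - sInf (f '' X) ≤ F} ∩
        {y | ‖X.indicator (gradient f) y‖ ≤ G / 2})) ∩
      ⋂ s ∈ Set.Iio t, (gradNoise X f g x s) ⁻¹' {e | ‖e‖ ≤ B} := by
    ext ω
    simp only [goodEvent, Set.mem_ofPred_eq, Set.mem_inter_iff, Set.mem_iInter, Set.mem_Iic,
      Set.mem_Iio, Set.mem_preimage]
    refine and_congr_left fun _ => forall₂_congr fun s _ => ?_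
    by_cases h : x s ω ∈ X <;> simp [h]
  have hfm : Measurable (X.indicator f) :=
    measurable_indicator_of_continuousOn hf.isOpen hf.differentiable.continuousOn
  have hgm : Measurable (X.indicator (gradient f)) :=
    measurable_indicator_of_continuousOn hf.isOpen hs.continuousOn_gradient
  rw [h1]
  refine MeasurableSet.inter
    (MeasurableSet.biInter (Set.to_countable _) fun s h => run.measurable_iterate_of_le h ?_)
    (MeasurableSet.biInter (Set.to_countable _) fun s h => run.measurable_gradNoise hf hs h ?_)
  · exact (hf.isOpen.measurableSet.inter
      (measurableSet_le (hfm.sub_const _) measurable_const)).inter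
      (measurableSet_le hgm.norm measurable_const)
  · exact measurableSet_le measurable_norm measurable_const

theorem IsSGDRun.measurable_gap (run : IsSGDRun μ X f σ η x₀ g x)
    (hf : IsObjective X f) (hs : IsRLSmooth X f r ℓ) (t : ℕ) :
    Measurable ((goodEvent X f g x G F B t).indicator
      (fun ω => f (x t ω) - sInf (f '' X))) := by
  have h1 : (goodEvent X f g x G F B t).indicator (fun ω => f (x t ω) - sInf (f '' X)) =
      (goodEvent X f g x G F B t).indicator
        (fun ω => X.indicator f (x t ω) - sInf (f '' X)) :=
    Set.indicator_congr fun ω hω => by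
      rw [Set.indicator_of_mem (mem_of_mem_goodEvent hω)]
  rw [h1]
  exact (((measurable_indicator_of_continuousOn hf.isOpen
    hf.differentiable.continuousOn).comp
      ((run.measurable_iterate t).mono (run.pastSigma_le t) le_rfl)).sub_const _).indicator
    (run.pastSigma_le t _ (run.measurableSet_goodEvent hf hs t))

theorem IsSGDRun.measurable_indicator_gradient (run : IsSGDRun μ X f σ η x₀ g x)
    (hf : IsObjective X f) (hs : IsRLSmooth X f r ℓ) {s t : ℕ} (h : s ≤ t) :
    Measurable[pastSigma g t] ((goodEvent X f g x G F B t).indicator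
      (fun ω => gradient f (x s ω))) := by
  have h1 : (goodEvent X f g x G F B t).indicator (fun ω => gradient f (x s ω)) =
      (goodEvent X f g x G F B t).indicator
        (fun ω => X.indicator (gradient f) (x s ω)) :=
    Set.indicator_congr fun ω hω => by
      rw [Set.indicator_of_mem (mem_of_mem_goodEvent (goodEvent_subset_of_le h hω))]
  rw [h1]
  exact Measurable.indicator ((measurable_indicator_of_continuousOn hf.isOpen
    hs.continuousOn_gradient).comp (run.measurable_iterate_of_le h))
      (run.measurableSet_goodEvent hf hs t)

theorem IsSGDRun.measurableSet_exitEvent (run : IsSGDRun μ X f σ η x₀ g x)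
    (hf : IsObjective X f) (hs : IsRLSmooth X f r ℓ) (t : ℕ) :
    MeasurableSet (exitEvent X f g x G F B t) := by
  refine ((run.pastSigma_le t _ (run.measurableSet_goodEvent hf hs t)).inter ?_).diff
    (run.pastSigma_le _ _ (run.measurableSet_goodEvent hf hs (t + 1)))
  exact measurableSet_le (((run.measurable_gradNoise hf hs t.lt_succ_self).mono
    (run.pastSigma_le _) le_rfl).norm) measurable_const

end Drift

/-! ### Exit probability and expected squared gradients -/

section Moments

variable {d : ℕ} {Ω : Type*} [mΩ : MeasurableSpace Ω] {μ : Measure Ω} [IsProbabilityMeasure μ]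
  {X : Set (EuclideanSpace ℝ (Fin d))} {f : EuclideanSpace ℝ (Fin d) → ℝ}
  {r ℓ : ℝ → ℝ} {σ η G F B : ℝ} {x₀ : EuclideanSpace ℝ (Fin d)}
  {g x : ℕ → Ω → EuclideanSpace ℝ (Fin d)}

theorem IsSGDRun.integrable_gap (run : IsSGDRun μ X f σ η x₀ g x)
    (hf : IsObjective X f) (hs : IsRLSmooth X f r ℓ) (hF : 0 ≤ F) (t : ℕ) :
    Integrable ((goodEvent X f g x G F B t).indicator
      (fun ω => f (x t ω) - sInf (f '' X))) μ := by
  refine Integrable.of_bound (run.measurable_gap hf hs t).aestronglyMeasurable F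
    (ae_of_all _ fun ω => ?_)
  by_cases h : ω ∈ goodEvent X f g x G F B t
  · rw [Set.indicator_of_mem h, Real.norm_eq_abs,
      abs_of_nonneg (sub_nonneg.2 (hf.sInf_le (mem_of_mem_goodEvent h)))]
    exact (h.1 t le_rfl).2.1
  · rw [Set.indicator_of_notMem h, norm_zero]; exact hF

theorem IsSGDRun.integrable_sq_gradient (run : IsSGDRun μ X f σ η x₀ g x)
    (hf : IsObjective X f) (hs : IsRLSmooth X f r ℓ) (t : ℕ) :
    Integrable ((goodEvent X f g x G F B (t + 1)).indicator
      (fun ω => ‖gradient f (x t ω)‖ ^ 2)) μ := by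
  have h1 : (goodEvent X f g x G F B (t + 1)).indicator (fun ω => ‖gradient f (x t ω)‖ ^ 2) =
      fun ω => ‖(goodEvent X f g x G F B (t + 1)).indicator
        (fun ω => gradient f (x t ω)) ω‖ ^ 2 := by
    ext ω
    by_cases h : ω ∈ goodEvent X f g x G F B (t + 1) <;> simp [h]
  have hm := (run.measurable_indicator_gradient (G := G) (F := F) (B := B) hf hs
    t.le_succ).mono (run.pastSigma_le _) le_rfl
  rw [h1]
  refine Integrable.of_bound (hm.norm.pow_const 2).aestronglyMeasurable ((G / 2) ^ 2)
    (ae_of_all _ fun ω => ?_)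
  rw [norm_pow, norm_norm]
  by_cases h : ω ∈ goodEvent X f g x G F B (t + 1)
  · rw [Set.indicator_of_mem h]
    exact pow_le_pow_left₀ (norm_nonneg _) (h.1 t t.le_succ).2.2 2
  · rw [Set.indicator_of_notMem h, norm_zero, zero_pow two_ne_zero]; positivity

theorem IsSGDRun.integral_drift (run : IsSGDRun μ X f σ η x₀ g x) (hf : IsObjective X f)
    (hs : IsRLSmooth X f r ℓ) (hreg : IsRegime r ℓ η G B) (hF : F = G ^ 2 / (200 * ℓ G))
    (t : ℕ) :
    ∫ ω, (goodEvent X f g x G F B (t + 1)).indicator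
        (fun ω => f (x (t + 1) ω) - sInf (f '' X)) ω ∂μ
      + η / 2 * ∫ ω, (goodEvent X f g x G F B (t + 1)).indicator
          (fun ω => ‖gradient f (x t ω)‖ ^ 2) ω ∂μ
      + F * μ.real (exitEvent X f g x G F B t)
    ≤ ∫ ω, (goodEvent X f g x G F B t).indicator (fun ω => f (x t ω) - sInf (f '' X)) ω ∂μ
      + (η * G / (10 * B) + ℓ G * η ^ 2) * σ ^ 2 := by
  have hL := hs.l_pos G hreg.G_pos.le
  have hη := hreg.η_pos
  have hG := hreg.G_pos
  have hB := hreg.B_pos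
  have hF0 : 0 ≤ F := by rw [hF]; positivity
  have i1 := run.integrable_gap (G := G) (B := B) hf hs hF0 t
  have i2 := run.integrable_gap (G := G) (B := B) hf hs hF0 (t + 1)
  have i3 := run.integrable_sq_gradient (G := G) (F := F) (B := B) hf hs t
  have i4 := run.integrable_sq_noise t
  have hE := run.measurableSet_exitEvent (G := G) (F := F) (B := B) hf hs t
  have i5 : Integrable ((exitEvent X f g x G F B t).indicator (1 : Ω → ℝ)) μ :=
    (integrable_const 1).indicator hE
  obtain ⟨i6, h6⟩ := run.integral_inner_noise t
    (run.measurable_indicator_gradient (G := G) (F := F) (B := B) hf hs le_rfl) (c := G / 2)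
    fun ω => by
      by_cases h : ω ∈ goodEvent X f g x G F B t
      · rw [Set.indicator_of_mem h]; exact (h.1 t le_rfl).2.2
      · rw [Set.indicator_of_notMem h, norm_zero]; positivity
  have key := integral_mono ((i2.add (i3.const_mul (η / 2))).add (i5.const_mul F))
    ((i1.sub (i6.const_mul η)).add (i4.const_mul (η * G / (10 * B) + ℓ G * η ^ 2)))
    (fun ω => run.drift hf hs hreg hF t ω)
  rw [integral_add' (i2.add (i3.const_mul (η / 2))) (i5.const_mul F),
    integral_add' i2 (i3.const_mul (η / 2)),
    integral_add' (i1.sub (i6.const_mul η)) (i4.const_mul _),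
    integral_sub' i1 (i6.const_mul η), integral_const_mul, integral_const_mul,
    integral_const_mul, integral_const_mul, h6, integral_indicator_one hE] at key
  have h7 := mul_le_mul_of_nonneg_left (run.integral_sq_noise_le t)
    (by positivity : 0 ≤ η * G / (10 * B) + ℓ G * η ^ 2)
  linarith

/-- The expected drift inequality, telescoped over the first `n` steps. -/
theorem IsSGDRun.sum_drift (run : IsSGDRun μ X f σ η x₀ g x) (hf : IsObjective X f)
    (hs : IsRLSmooth X f r ℓ) (hreg : IsRegime r ℓ η G B) (hF : F = G ^ 2 / (200 * ℓ G))
    (hx₀ : x₀ ∈ X) (n : ℕ) :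
    η / 2 * ∑ t ∈ Finset.range n, ∫ ω, (goodEvent X f g x G F B (t + 1)).indicator
          (fun ω => ‖gradient f (x t ω)‖ ^ 2) ω ∂μ
      + F * ∑ t ∈ Finset.range n, μ.real (exitEvent X f g x G F B t)
    ≤ initialGap X f x₀ + n * ((η * G / (10 * B) + ℓ G * η ^ 2) * σ ^ 2) := by
  have hL := hs.l_pos G hreg.G_pos.le
  have hF0 : 0 ≤ F := by rw [hF]; positivity
  have key : ∫ ω, (goodEvent X f g x G F B n).indicator
        (fun ω => f (x n ω) - sInf (f '' X)) ω ∂μ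
      + η / 2 * ∑ t ∈ Finset.range n, ∫ ω, (goodEvent X f g x G F B (t + 1)).indicator
          (fun ω => ‖gradient f (x t ω)‖ ^ 2) ω ∂μ
      + F * ∑ t ∈ Finset.range n, μ.real (exitEvent X f g x G F B t)
      ≤ initialGap X f x₀ + n * ((η * G / (10 * B) + ℓ G * η ^ 2) * σ ^ 2) := by
    induction n with
    | zero =>
      have h1 : ∫ ω, (goodEvent X f g x G F B 0).indicator
          (fun ω => f (x 0 ω) - sInf (f '' X)) ω ∂μ ≤ ∫ _, initialGap X f x₀ ∂μ := by
        refine integral_mono (run.integrable_gap hf hs hF0 0) (integrable_const _) fun ω => ?_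
        by_cases h : ω ∈ goodEvent X f g x G F B 0
        · simp only [Set.indicator_of_mem h, run.init, initialGap, le_refl]
        · simp only [Set.indicator_of_notMem h]
          exact sub_nonneg.2 (hf.sInf_le hx₀)
      simpa using h1
    | succ n ih =>
      have h1 := run.integral_drift hf hs hreg hF n
      rw [Finset.sum_range_succ, Finset.sum_range_succ]
      push_cast
      linarith
  have h2 : 0 ≤ ∫ ω, (goodEvent X f g x G F B n).indicator
      (fun ω => f (x n ω) - sInf (f '' X)) ω ∂μ :=
    integral_nonneg fun ω => Set.indicator_nonneg
      (fun ω h => sub_nonneg.2 (hf.sInf_le (mem_of_mem_goodEvent h))) ω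
  linarith

theorem IsSGDRun.measureReal_goodEvent_compl_le (run : IsSGDRun μ X f σ η x₀ g x)
    (hB : 0 < B) (h0 : goodEvent X f g x G F B 0 = Set.univ) (n : ℕ) :
    μ.real (goodEvent X f g x G F B n)ᶜ
      ≤ n * (σ ^ 2 / B ^ 2) + ∑ t ∈ Finset.range n, μ.real (exitEvent X f g x G F B t) := by
  induction n with
  | zero => simp [h0]
  | succ n ih =>
    have h1 : (goodEvent X f g x G F B (n + 1))ᶜ ⊆ (goodEvent X f g x G F B n)ᶜ ∪
        ({ω | B < ‖gradNoise X f g x n ω‖} ∪ exitEvent X f g x G F B n) := by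
      intro ω hω
      by_cases h2 : ω ∈ goodEvent X f g x G F B n
      · by_cases h3 : ‖gradNoise X f g x n ω‖ ≤ B
        · exact Or.inr (Or.inr ⟨⟨h2, h3⟩, hω⟩)
        · exact Or.inr (Or.inl (not_le.1 h3))
      · exact Or.inl h2
    have h2 := (measureReal_mono (μ := μ) h1).trans ((measureReal_union_le _ _).trans
      (add_le_add_right (measureReal_union_le _ _) _))
    have h3 := run.measureReal_noise_gt_le n hB
    rw [Finset.sum_range_succ]
    push_cast
    linarith

/-- Failure probability bound: the union of the exits, the large noises, and (by Markov's
inequality) the event that the squared gradients of a good run sum to more than `S`. -/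
theorem IsSGDRun.one_sub_le_measureReal (run : IsSGDRun μ X f σ η x₀ g x) (hf : IsObjective X f)
    (hs : IsRLSmooth X f r ℓ) (hreg : IsRegime r ℓ η G B) (hF : F = G ^ 2 / (200 * ℓ G))
    (hx₀ : x₀ ∈ X) (h0 : goodEvent X f g x G F B 0 = Set.univ) {n : ℕ} {M S : ℝ} (hS : 0 < S)
    (hM : initialGap X f x₀ + n * ((η * G / (10 * B) + ℓ G * η ^ 2) * σ ^ 2) ≤ M) :
    1 - (n * (σ ^ 2 / B ^ 2) + M / F + 2 * M / η / S) ≤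
      μ.real {ω | ω ∈ goodEvent X f g x G F B n ∧
        ∑ t ∈ Finset.range n, ‖gradient f (x t ω)‖ ^ 2 ≤ S} := by
  have hL := hs.l_pos G hreg.G_pos.le
  have hG := hreg.G_pos
  have hη := hreg.η_pos
  have hF0 : 0 < F := by rw [hF]; positivity
  set W : ℕ → Ω → ℝ := fun t => (goodEvent X f g x G F B (t + 1)).indicator
    (fun ω => ‖gradient f (x t ω)‖ ^ 2) with hW
  have hW0 : ∀ t ω, 0 ≤ W t ω := fun t ω => Set.indicator_nonneg (fun _ _ => sq_nonneg _) ω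
  have hWi : ∀ t, Integrable (W t) μ := fun t => run.integrable_sq_gradient hf hs t
  have hsum := (run.sum_drift hf hs hreg hF hx₀ n).trans hM
  have hp0 : 0 ≤ ∑ t ∈ Finset.range n, μ.real (exitEvent X f g x G F B t) :=
    Finset.sum_nonneg fun _ _ => measureReal_nonneg
  have hw0 : 0 ≤ ∑ t ∈ Finset.range n, ∫ ω, W t ω ∂μ :=
    Finset.sum_nonneg fun t _ => integral_nonneg (hW0 t)
  have hexit : ∑ t ∈ Finset.range n, μ.real (exitEvent X f g x G F B t) ≤ M / F := by
    rw [le_div_iff₀ hF0]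
    nlinarith [mul_nonneg hη.le hw0]
  have hgrad : μ.real {ω | S ≤ ∑ t ∈ Finset.range n, W t ω} ≤ 2 * M / η / S := by
    have h1 := mul_meas_ge_le_integral_of_nonneg (μ := μ)
      (ae_of_all _ fun ω => Finset.sum_nonneg fun t (_ : t ∈ Finset.range n) => hW0 t ω)
      (integrable_finsetSum _ fun t _ => hWi t) S
    rw [integral_finsetSum _ fun t _ => hWi t] at h1
    rw [le_div_iff₀ hS, le_div_iff₀ hη]
    nlinarith [mul_nonneg hF0.le hp0]
  have hbad := run.measureReal_goodEvent_compl_le hreg.B_pos h0 n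
  have hcover : (Set.univ : Set Ω) ⊆ {ω | ω ∈ goodEvent X f g x G F B n ∧
        ∑ t ∈ Finset.range n, ‖gradient f (x t ω)‖ ^ 2 ≤ S} ∪
      ((goodEvent X f g x G F B n)ᶜ ∪ {ω | S ≤ ∑ t ∈ Finset.range n, W t ω}) := by
    intro ω _
    by_cases h1 : ω ∈ goodEvent X f g x G F B n
    · have h2 : ∑ t ∈ Finset.range n, W t ω
          = ∑ t ∈ Finset.range n, ‖gradient f (x t ω)‖ ^ 2 :=
        Finset.sum_congr rfl fun t ht => Set.indicator_of_mem
          (goodEvent_subset_of_le (Nat.succ_le_of_lt (Finset.mem_range.1 ht)) h1) _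
      rcases le_total (∑ t ∈ Finset.range n, W t ω) S with h3 | h3
      · exact Or.inl ⟨h1, h2 ▸ h3⟩
      · exact Or.inr (Or.inr h3)
    · exact Or.inr (Or.inl h1)
  have h1 := (measureReal_mono (μ := μ) hcover).trans ((measureReal_union_le _ _).trans
    (add_le_add_right (measureReal_union_le _ _) _))
  rw [probReal_univ] at h1
  linarith

end Moments

/-! ### Constants -/

section Constants

variable {r ℓ : ℝ → ℝ} {Δ₀ γ σ δ G ε η : ℝ}

theorem IsGradBound.mul_le (h : IsGradBound ℓ Δ₀ γ σ δ G) (hδ : 0 < δ)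
    (hM : 0 ≤ Δ₀ + 2 * σ) (hL : 0 < ℓ G) : 1600 * ((Δ₀ + 2 * σ) * ℓ G) ≤ δ * G ^ 2 := by
  have h1 : 40 * √((Δ₀ + 2 * σ) * ℓ G / δ) ≤ G :=
    ((le_max_left _ _).trans (le_max_left _ _)).trans h.2
  have h2 : 0 ≤ (Δ₀ + 2 * σ) * ℓ G / δ := by positivity
  have h3 := pow_le_pow_left₀ (by positivity) h1 2
  rw [mul_pow, Real.sq_sqrt h2] at h3
  have h4 : δ * (40 ^ 2 * ((Δ₀ + 2 * σ) * ℓ G / δ)) = 1600 * ((Δ₀ + 2 * σ) * ℓ G) := by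
    field_simp; ring
  rw [← h4]
  exact mul_le_mul_of_nonneg_left h3 hδ.le

theorem IsGradBound.two_mul_le (h : IsGradBound ℓ Δ₀ γ σ δ G) : 2 * γ ≤ G :=
  ((le_max_right _ _).trans (le_max_left _ _)).trans h.2

/-- This is where sub-quadratic growth of `ℓ` enters. -/
theorem exists_isGradBound (hsub : IsSubQuadratic ℓ) (hδ : 0 < δ) (hM : 0 ≤ Δ₀ + 2 * σ) :
    ∃ G, IsGradBound ℓ Δ₀ γ σ δ G := by
  set c : ℝ := δ / (1600 * (Δ₀ + 2 * σ) + 1) with hc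
  have hc0 : 0 < c := by positivity
  obtain ⟨G, h1, h2⟩ := ((hsub.bound hc0).and
    (Filter.eventually_ge_atTop (max 1 (max (2 * γ) σ)))).exists
  have hG : 1 ≤ G := (le_max_left _ _).trans h2
  refine ⟨G, by linarith, max_le (max_le ?_ ?_) ?_⟩
  · have h3 : ℓ G ≤ c * G ^ 2 := by
      refine (le_abs_self _).trans ?_
      simpa using h1
    have h4 : (Δ₀ + 2 * σ) * ℓ G / δ ≤ (G / 40) ^ 2 := by
      have h5 : (Δ₀ + 2 * σ) * ℓ G ≤ (Δ₀ + 2 * σ) * (c * G ^ 2) :=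
        mul_le_mul_of_nonneg_left h3 hM
      have h6 : 1600 * (Δ₀ + 2 * σ) * c ≤ δ := by
        rw [hc, mul_div_assoc', div_le_iff₀ (by positivity)]
        nlinarith
      rw [div_le_iff₀ hδ]
      nlinarith [mul_le_mul_of_nonneg_right h6 (sq_nonneg G)]
    have h7 := Real.sqrt_le_sqrt h4
    rw [Real.sqrt_sq (by linarith)] at h7
    linarith
  · exact ((le_max_left _ _).trans (le_max_right _ _)).trans h2
  · exact ((le_max_right _ _).trans (le_max_right _ _)).trans h2

theorem sq_le_noiseConst : G ^ 2 ≤ noiseConst r σ δ G := le_max_left _ _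

theorem noiseConst_pos (hG : 0 < G) : 0 < noiseConst r σ δ G :=
  (pow_pos hG 2).trans_le sq_le_noiseConst

theorem sq_le_mul_noiseConst (hr : 0 < r G) (hδ : 0 < δ) :
    400 * σ ^ 2 ≤ noiseConst r σ δ G * (r G ^ 2 * δ) := by
  rw [← div_le_iff₀ (by positivity)]
  exact le_max_right _ _

theorem horizon_pos (hG : 0 < G) (hη : 0 < η) : 0 < horizon r σ δ G η := by
  have := noiseConst_pos (r := r) (σ := σ) (δ := δ) hG
  rw [horizon]; positivity

/-- The noise threshold used is `1 / (η w)` with `w = 2 / r G + 4 ℓ G / G`; the two summands keep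
the step in the ball of radius `r G` and the change of the gradient small. -/
theorem isRegime (hr : 0 < r G) (hL : 0 < ℓ G) (hG : 0 < G) (hδ : δ < 1)
    (h : IsStepsize r ℓ Δ₀ σ δ G ε η) :
    IsRegime r ℓ η G (1 / (η * (2 / r G + 4 * ℓ G / G))) := by
  obtain ⟨hη, h1, -⟩ := h
  have h2 := h1.trans (min_le_left _ _)
  have h3 := h1.trans (min_le_right _ _)
  rw [le_div_iff₀ (by positivity)] at h2 h3
  set w := 2 / r G + 4 * ℓ G / G with hw
  have hw1 : 2 / r G ≤ w := le_add_of_nonneg_right (by positivity)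
  have hw2 : 4 * ℓ G / G ≤ w := le_add_of_nonneg_left (by positivity)
  have hw0 : 0 < w := by positivity
  have h4 : η * (1 / (η * w)) = 1 / w := by field_simp
  refine ⟨hη, hG, by positivity, by linarith, by linarith, ?_, ?_⟩
  · rw [h4, div_le_iff₀ hw0]
    rw [div_le_iff₀ hr] at hw1
    linarith
  · rw [h4, mul_one_div, div_le_iff₀ hw0]
    rw [div_le_iff₀ hG] at hw2
    linarith

/-- The choice of `C` controls the summand `2 / r G` of the noise threshold, the condition on `G`
the summand `4 ℓ G / G`. -/
theorem sq_mul_sq_le_noiseConst (hr : 0 < r G) (hL : 0 < ℓ G) (hΔ : 0 ≤ Δ₀) (hσ : 0 ≤ σ)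
    (hδ₀ : 0 < δ) (hδ₁ : δ < 1) (h : IsGradBound ℓ Δ₀ γ σ δ G) :
    σ ^ 2 * (2 / r G + 4 * ℓ G / G) ^ 2 ≤ δ / 25 * noiseConst r σ δ G := by
  have hG := h.1
  set C := noiseConst r σ δ G with hC
  have h1 : 400 * σ ^ 2 ≤ C * (r G ^ 2 * δ) := sq_le_mul_noiseConst hr hδ₀
  have h2 : G ^ 2 ≤ C := sq_le_noiseConst
  have h3 := h.mul_le hδ₀ (by positivity) hL
  have h4 : 3200 * (σ * ℓ G) ≤ δ * G ^ 2 := by nlinarith [mul_nonneg hΔ hL.le]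
  have h5 : σ ^ 2 * (2 / r G) ^ 2 ≤ δ / 100 * C := by
    have : σ ^ 2 * (2 / r G) ^ 2 = 4 * σ ^ 2 / r G ^ 2 := by field_simp; norm_num
    rw [this, div_le_iff₀ (by positivity)]
    linarith
  have h6 : σ * (4 * ℓ G / G) ≤ δ * G / 800 := by
    rw [mul_div_assoc', div_le_iff₀ hG]
    linarith
  have h7 : σ ^ 2 * (4 * ℓ G / G) ^ 2 ≤ δ / 100 * C := by
    have h8 := pow_le_pow_left₀ (by positivity) h6 2
    have h9 : δ ^ 2 * G ^ 2 ≤ δ * C := by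
      have : δ ^ 2 ≤ δ := by nlinarith
      exact mul_le_mul this h2 (by positivity) hδ₀.le
    rw [mul_pow] at h8
    nlinarith
  nlinarith [mul_nonneg (sq_nonneg σ) (sq_nonneg (2 / r G - 4 * ℓ G / G))]

/-- At most `2 T` iterations contribute at most `2 σ` of noise to the drift, which explains the
term `Δ₀ + 2 σ` in the condition on `G`. -/
theorem drift_noise_le (hr : 0 < r G) (hL : 0 < ℓ G) (hΔ : 0 ≤ Δ₀) (hσ : 0 ≤ σ)
    (hδ₀ : 0 < δ) (hδ₁ : δ < 1) (h : IsGradBound ℓ Δ₀ γ σ δ G) (hη : 0 < η) {n : ℝ}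
    (hn : n ≤ 2 * horizon r σ δ G η) :
    n * ((η * G / (10 * (1 / (η * (2 / r G + 4 * ℓ G / G)))) + ℓ G * η ^ 2) * σ ^ 2)
      ≤ 2 * σ := by
  have hG := h.1
  have h1 := sq_mul_sq_le_noiseConst hr hL hΔ hσ hδ₀ hδ₁ h
  have hC0 : 0 < noiseConst r σ δ G := noiseConst_pos hG
  have hGC : G ^ 2 ≤ noiseConst r σ δ G := sq_le_noiseConst
  rw [horizon] at hn
  set C := noiseConst r σ δ G with hC
  set w := 2 / r G + 4 * ℓ G / G with hw
  have hw0 : 0 < w := by positivity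
  have h3 := h.mul_le hδ₀ (by positivity) hL
  have h4 : σ * ℓ G ≤ C / 3200 := by
    nlinarith [mul_nonneg hΔ hL.le, mul_nonneg hσ hL.le, sq_nonneg G]
  have h5 : σ * w * G ≤ C := by
    refine le_of_sq_le_sq ?_ hC0.le
    have : σ ^ 2 * w ^ 2 ≤ C := by nlinarith
    calc (σ * w * G) ^ 2 = σ ^ 2 * w ^ 2 * G ^ 2 := by ring
      _ ≤ C * C := mul_le_mul this hGC (by positivity) hC0.le
      _ = C ^ 2 := by ring
  have h6 : (η * G / (10 * (1 / (η * w))) + ℓ G * η ^ 2) * σ ^ 2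
      = η ^ 2 * (σ * (σ * w * G / 10 + σ * ℓ G)) := by field_simp
  have h7 : η ^ 2 * (σ * (σ * w * G / 10 + σ * ℓ G)) ≤ η ^ 2 * (σ * C) := by
    gcongr
    linarith
  have h8 : 2 * (1 / (C * η ^ 2)) * (η ^ 2 * (σ * C)) = 2 * σ := by field_simp
  rw [h6, ← h8]
  exact mul_le_mul hn h7 (by positivity) (by positivity)

/-- By Chebyshev's inequality, some noise exceeds the threshold within `2 T` iterations with
probability at most `2 δ / 25`. -/
theorem noise_prob_le (hr : 0 < r G) (hL : 0 < ℓ G) (hΔ : 0 ≤ Δ₀) (hσ : 0 ≤ σ)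
    (hδ₀ : 0 < δ) (hδ₁ : δ < 1) (h : IsGradBound ℓ Δ₀ γ σ δ G) (hη : 0 < η) {n : ℝ}
    (hn : n ≤ 2 * horizon r σ δ G η) :
    n * (σ ^ 2 / (1 / (η * (2 / r G + 4 * ℓ G / G))) ^ 2) ≤ 2 * δ / 25 := by
  have hG := h.1
  have h1 := sq_mul_sq_le_noiseConst hr hL hΔ hσ hδ₀ hδ₁ h
  have hC0 : 0 < noiseConst r σ δ G := noiseConst_pos hG
  rw [horizon] at hn
  set C := noiseConst r σ δ G with hC
  set w := 2 / r G + 4 * ℓ G / G with hw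
  have hw0 : 0 < w := by positivity
  have h6 : σ ^ 2 / (1 / (η * w)) ^ 2 = η ^ 2 * (σ ^ 2 * w ^ 2) := by field_simp
  have h8 : 2 * (1 / (C * η ^ 2)) * (η ^ 2 * (δ / 25 * C)) = 2 * δ / 25 := by field_simp
  rw [h6, ← h8]
  exact mul_le_mul hn (mul_le_mul_of_nonneg_left h1 (by positivity)) (by positivity)
    (by positivity)

end Constants

/-! ### Convergence with high probability -/

section Convergence

variable {d : ℕ} {Ω : Type*} [MeasurableSpace Ω] {μ : Measure Ω} [IsProbabilityMeasure μ]
  {X : Set (EuclideanSpace ℝ (Fin d))} {f : EuclideanSpace ℝ (Fin d) → ℝ}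
  {r ℓ : ℝ → ℝ} {x₀ : EuclideanSpace ℝ (Fin d)} {σ δ G ε η : ℝ}
  {g x : ℕ → Ω → EuclideanSpace ℝ (Fin d)}

/-- The failure probability is at most `2 δ / 25` for large noise, `δ / 8` for a jump of the gap
above `F`, and `δ / 4` for a large sum of squared gradients. -/
theorem IsSGDRun.convergence (run : IsSGDRun μ X f σ η x₀ g x) (hf : IsObjective X f)
    (hs : IsRLSmooth X f r ℓ) (hx₀ : x₀ ∈ X) (hσ : 0 ≤ σ) (hδ₀ : 0 < δ) (hδ₁ : δ < 1)
    (hG : IsGradBound ℓ (initialGap X f x₀) ‖gradient f x₀‖ σ δ G) (hε : 0 < ε)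
    (hη : IsStepsize r ℓ (initialGap X f x₀) σ δ G ε η) :
    1 - δ ≤ μ.real {ω |
      (∀ t : ℕ, (t : ℝ) < horizon r σ δ G η → x t ω ∈ X ∧ ‖gradient f (x t ω)‖ ≤ G) ∧
      1 / horizon r σ δ G η *
        ∑ t ∈ Finset.range ⌈horizon r σ δ G η⌉₊, ‖gradient f (x t ω)‖ ^ 2 ≤ ε ^ 2} := by
  have hG0 := hG.1
  have hL := hs.l_pos G hG0.le
  have hr := hs.r_pos G hG0.le
  have hη0 := hη.1
  have hΔ : 0 ≤ initialGap X f x₀ := sub_nonneg.2 (hf.sInf_le hx₀)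
  have hM : 0 ≤ initialGap X f x₀ + 2 * σ := by positivity
  have hT0 : 0 < horizon r σ δ G η := horizon_pos hG0 hη0
  have hC0 : 0 < noiseConst r σ δ G := noiseConst_pos hG0
  have hγ := hG.two_mul_le
  have hηε := hη.2.2
  have hGM := hG.mul_le hδ₀ hM hL
  have hreg := isRegime hr hL hG0 hδ₁ hη
  have hTdef : horizon r σ δ G η = 1 / (noiseConst r σ δ G * η ^ 2) := rfl
  set T := horizon r σ δ G η with hT
  set C := noiseConst r σ δ G with hC
  set Δ₀ := initialGap X f x₀ with hΔ₀
  rcases lt_or_ge T 1 with hT1 | hT1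
  · -- Only the deterministic iterate `x₀` counts.
    have hn : ⌈T⌉₊ = 1 := by
      rw [Nat.ceil_eq_iff one_ne_zero]; simpa using ⟨hT0, hT1.le⟩
    have h1 : 1 - δ ≤ μ.real (Set.univ : Set Ω) := by rw [probReal_univ]; linarith
    refine h1.trans (measureReal_mono fun ω _ => ⟨fun t ht => ?_, ?_⟩)
    · have : t = 0 := by
        have : (t : ℝ) < 1 := ht.trans hT1
        exact_mod_cast Nat.lt_one_iff.1 (by exact_mod_cast this)
      subst this
      rw [run.init]
      exact ⟨hx₀, by linarith [norm_nonneg (gradient f x₀)]⟩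
    · rw [hn, Finset.sum_range_one, run.init, hTdef, one_div_one_div]
      have h2 : ‖gradient f x₀‖ ^ 2 ≤ 2 * ℓ G * Δ₀ :=
        sq_norm_gradient_le hf hs hx₀ (by linarith)
      calc C * η ^ 2 * ‖gradient f x₀‖ ^ 2 ≤ C * η ^ 2 * (2 * ℓ G * Δ₀) := by gcongr
        _ = 2 * (ℓ G * η) * (η * C * Δ₀) := by ring
        _ ≤ 2 * (1 / 160) * (η * C * (Δ₀ + 2 * σ)) := by
          have := hreg.smooth
          gcongr
          linarith
        _ ≤ ε ^ 2 := by nlinarith [mul_nonneg (mul_nonneg hη0.le hC0.le) hM, sq_nonneg ε]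
  -- From here on `⌈T⌉ ≤ 2 T`, which the moment bounds need.
  set n := ⌈T⌉₊ with hn
  have hn2 : (n : ℝ) ≤ 2 * T := by linarith [Nat.ceil_lt_add_one hT0.le]
  set B := 1 / (η * (2 / r G + 4 * ℓ G / G)) with hB
  have hdrift := drift_noise_le hr hL hΔ hσ hδ₀ hδ₁ hG hη0 hn2
  have hnoise := noise_prob_le hr hL hΔ hσ hδ₀ hδ₁ hG hη0 hn2
  rw [← hB] at hdrift hnoise
  -- `F` is defined through `G` so that it is positive even if `Δ₀ + 2 σ = 0`.
  set F := G ^ 2 / (200 * ℓ G) with hF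
  have hMF : 8 * (Δ₀ + 2 * σ) ≤ δ * F := by
    rw [hF, mul_div_assoc', le_div_iff₀ (by positivity)]
    linarith
  have hF0 : 0 < F := by positivity
  have h0 : goodEvent X f g x G F B 0 = Set.univ := by
    refine Set.eq_univ_of_forall fun ω =>
      ⟨fun s hs0 => ?_, fun s hs0 => (Nat.not_lt_zero _ hs0).elim⟩
    rw [Nat.le_zero.1 hs0, run.init]
    refine ⟨hx₀, ?_, by linarith⟩
    change Δ₀ ≤ F
    nlinarith
  have hS : 0 < T * ε ^ 2 := by positivity
  have key := run.one_sub_le_measureReal hf hs hreg hF hx₀ h0 hS (n := n)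
    (M := Δ₀ + 2 * σ) (by linarith)
  have hMF' : (Δ₀ + 2 * σ) / F ≤ δ / 8 := by
    rw [div_le_iff₀ hF0]; linarith
  have hMS : 2 * (Δ₀ + 2 * σ) / η / (T * ε ^ 2) ≤ δ / 4 := by
    have : 2 * (Δ₀ + 2 * σ) / η / (T * ε ^ 2)
        = η * (8 * C * (Δ₀ + 2 * σ)) / (4 * ε ^ 2) := by
      rw [hTdef]; field_simp; ring
    rw [this, div_le_iff₀ (by positivity)]
    linarith
  refine le_trans (by linarith) (key.trans (measureReal_mono ?_))
  rintro ω ⟨h1, h2⟩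
  refine ⟨fun t ht => ?_, ?_⟩
  · obtain ⟨h3, -, h4⟩ := h1.1 t (Nat.lt_ceil.2 ht).le
    exact ⟨h3, by linarith⟩
  · rw [one_div_mul_eq_div, div_le_iff₀ hT0, mul_comm]
    exact h2

/-- If the squared gradients average to at most `ε ^ 2`, one of them is at most `ε ^ 2`. -/
theorem exists_norm_gradient_le {T : ℝ} {p : ℕ → EuclideanSpace ℝ (Fin d)} (hT : 0 < T)
    (hε : 0 < ε) (h : 1 / T * ∑ t ∈ Finset.range ⌈T⌉₊, ‖p t‖ ^ 2 ≤ ε ^ 2) :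
    ∃ t < ⌈T⌉₊, ‖p t‖ ≤ ε := by
  by_contra! hcon
  rw [one_div_mul_eq_div, div_le_iff₀ hT] at h
  have h1 : ∑ _t ∈ Finset.range ⌈T⌉₊, ε ^ 2 < ∑ t ∈ Finset.range ⌈T⌉₊, ‖p t‖ ^ 2 :=
    Finset.sum_lt_sum_of_nonempty
      (Finset.nonempty_range_iff.2 (Nat.ceil_pos.2 hT).ne')
      fun t ht => pow_lt_pow_left₀ (hcon t (Finset.mem_range.1 ht)) hε.le two_ne_zero
  rw [Finset.sum_const, Finset.card_range, nsmul_eq_mul] at h1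
  nlinarith [Nat.le_ceil T, sq_nonneg ε]

/-- A stepsize of order `ε ^ 2` is allowed, and its horizon is of order `ε ^ (-4)`. -/
theorem exists_isStepsize {Δ₀ : ℝ} (hG : 0 < G) (hr : 0 < r G) (hL : 0 < ℓ G) (hδ : 0 < δ)
    (hM : 0 ≤ Δ₀ + 2 * σ) :
    ∃ K : ℝ, 0 < K ∧ ∀ ε : ℝ, 0 < ε → ε ≤ 1 → ∃ η : ℝ, IsStepsize r ℓ Δ₀ σ δ G ε η ∧
      (⌈horizon r σ δ G η⌉₊ : ℝ) ≤ K / ε ^ 4 := by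
  have hC : 0 < noiseConst r σ δ G := noiseConst_pos hG
  set C := noiseConst r σ δ G with hCdef
  set a := min (δ / (160 * ℓ G)) (r G / (2 * G)) with ha
  have ha0 : 0 < a := lt_min (by positivity) (by positivity)
  -- The `+ 1` keeps `b` positive when `Δ₀ + 2 σ = 0`, where the bound it serves is void.
  set b := δ / (8 * C * (Δ₀ + 2 * σ) + 1) with hb
  have hb0 : 0 < b := by positivity
  set m := min a b with hm
  have hm0 : 0 < m := lt_min ha0 hb0
  refine ⟨1 / (C * m ^ 2) + 1, by positivity, fun ε hε hε1 =>
    ⟨m * ε ^ 2, ⟨by positivity, ?_, ?_⟩, ?_⟩⟩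
  · have h1 : ε ^ 2 ≤ 1 := pow_le_one₀ hε.le hε1
    exact (mul_le_of_le_one_right hm0.le h1).trans (min_le_left _ _)
  · have h1 : m * (8 * C * (Δ₀ + 2 * σ)) ≤ δ := by
      have h2 : m ≤ b := min_le_right _ _
      rw [hb, le_div_iff₀ (by positivity)] at h2
      linarith
    calc m * ε ^ 2 * (8 * C * (Δ₀ + 2 * σ)) = m * (8 * C * (Δ₀ + 2 * σ)) * ε ^ 2 := by ring
      _ ≤ δ * ε ^ 2 := by gcongr
  · have hT : horizon r σ δ G (m * ε ^ 2) = 1 / (C * m ^ 2) / ε ^ 4 := by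
      rw [horizon, ← hCdef]; field_simp
    have h1 : 1 ≤ 1 / ε ^ 4 := by
      rw [le_div_iff₀ (by positivity), one_mul]; exact pow_le_one₀ hε.le hε1
    have h2 := Nat.ceil_lt_add_one (horizon_pos (r := r) (σ := σ) (δ := δ) hG
      (by positivity : 0 < m * ε ^ 2)).le
    rw [add_div, ← hT]
    linarith

end Convergence

end GenSmooth

theorem mainTheorem2 {d : ℕ} {Ω : Type*} [MeasurableSpace Ω] (μ : Measure Ω)
    [IsProbabilityMeasure μ]
    (X : Set (EuclideanSpace ℝ (Fin d))) (f : EuclideanSpace ℝ (Fin d) → ℝ)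
    (r ℓ : ℝ → ℝ) (x₀ : EuclideanSpace ℝ (Fin d)) (σ δ : ℝ)
    (hf : GenSmooth.IsObjective X f) (hsmooth : GenSmooth.IsRLSmooth X f r ℓ)
    (hsub : GenSmooth.IsSubQuadratic ℓ)
    (hx₀ : x₀ ∈ X) (hσ : 0 ≤ σ) (hδ₀ : 0 < δ) (hδ₁ : δ < 1) :
    -- a suitable constant `G` exists
    (∃ G : ℝ, GenSmooth.IsGradBound ℓ (GenSmooth.initialGap X f x₀) ‖gradient f x₀‖ σ δ G) ∧
    ∀ G : ℝ, GenSmooth.IsGradBound ℓ (GenSmooth.initialGap X f x₀) ‖gradient f x₀‖ σ δ G →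
      -- bounded gradients and convergence, with probability at least `1 - δ`
      (∀ ε : ℝ, 0 < ε → ∀ η : ℝ,
        GenSmooth.IsStepsize r ℓ (GenSmooth.initialGap X f x₀) σ δ G ε η →
        ∀ g x : ℕ → Ω → EuclideanSpace ℝ (Fin d), GenSmooth.IsSGDRun μ X f σ η x₀ g x →
          1 - δ ≤ μ.real {ω |
            (∀ t : ℕ, (t : ℝ) < GenSmooth.horizon r σ δ G η →
              x t ω ∈ X ∧ ‖gradient f (x t ω)‖ ≤ G) ∧
            1 / GenSmooth.horizon r σ δ G η *
              ∑ t ∈ Finset.range ⌈GenSmooth.horizon r σ δ G η⌉₊, ‖gradient f (x t ω)‖ ^ 2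
                ≤ ε ^ 2}) ∧
      -- complexity `O(ε⁻⁴)` of finding an `ε`-stationary point
      (∃ K : ℝ, 0 < K ∧ ∀ ε : ℝ, 0 < ε → ε ≤ 1 → ∃ η : ℝ,
        GenSmooth.IsStepsize r ℓ (GenSmooth.initialGap X f x₀) σ δ G ε η ∧
        (⌈GenSmooth.horizon r σ δ G η⌉₊ : ℝ) ≤ K / ε ^ 4 ∧
        ∀ g x : ℕ → Ω → EuclideanSpace ℝ (Fin d), GenSmooth.IsSGDRun μ X f σ η x₀ g x →
          1 - δ ≤ μ.real {ω | ∃ t < ⌈GenSmooth.horizon r σ δ G η⌉₊,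
            x t ω ∈ X ∧ ‖gradient f (x t ω)‖ ≤ ε}) := by
  have hΔ : 0 ≤ GenSmooth.initialGap X f x₀ := sub_nonneg.2 (hf.sInf_le hx₀)
  have hM : 0 ≤ GenSmooth.initialGap X f x₀ + 2 * σ := by positivity
  refine ⟨GenSmooth.exists_isGradBound hsub hδ₀ hM, fun G hG => ⟨fun ε hε η hη g x run =>
    run.convergence hf hsmooth hx₀ hσ hδ₀ hδ₁ hG hε hη, ?_⟩⟩
  obtain ⟨K, hK, h⟩ := GenSmooth.exists_isStepsize (r := r) (ℓ := ℓ) (σ := σ) (δ := δ) hG.1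
    (hsmooth.r_pos G hG.1.le) (hsmooth.l_pos G hG.1.le) hδ₀ hM
  refine ⟨K, hK, fun ε hε hε1 => ?_⟩
  obtain ⟨η, hη, hT⟩ := h ε hε hε1
  refine ⟨η, hη, hT, fun g x run =>
    (run.convergence hf hsmooth hx₀ hσ hδ₀ hδ₁ hG hε hη).trans (measureReal_mono ?_)⟩
  rintro ω ⟨h1, h2⟩
  obtain ⟨t, ht, h3⟩ := GenSmooth.exists_norm_gradient_le (GenSmooth.horizon_pos hG.1 hη.1) hε h2
  exact ⟨t, ht, (h1 t (Nat.lt_ceil.1 ht)).1, h3⟩
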